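/- Let $\Delta$ be a complete unimodular fan in $V=\mathbb{R}^n$ with respect to the lattice $N=\mathbb{Z}^n$, and suppose that $\Delta$ is polytopal, i.e. $\Delta$ is the normal fan of an $n$-dimensional convex polytope $P\subset V^*$ (the collection, over all nonempty faces $F$ of $P$, of the cones spanned by the outward normal vectors to the facets of $P$ containing $F$). Equivalently, the toric variety $X_\Delta$ is smooth and projective. Let $\lambda(1),\dots,\lambda(m)\in N$ be the primitive generators of the rays of $\Delta$, and let $K$ be the simplicial complex on $[m]=\{1,\dots,m\}$ of those $I\subseteq[m]$ for which $\{\lambda(i)\}_{i\in I}$ spans a cone of $\Delta$. Describe the cohomology of $X_\Delta$ by the Danilov–Jurkiewicz presentation $$H^*(X_\Delta;\mathbb{R})=\mathbb{R}[v_1,\dots,v_m]\Big/\Big(v_{i_1}\cdots v_{i_s}\ \big(\{i_1,\dots,i_s\}\notin K\big),\ \ \sum_{i\in[m]}\langle\mu,\lambda(i)\rangle v_i\ \big(\mu\in \mathrm{Hom}(N,\mathbb{Z})\big)\Big),\qquad \deg v_i=2.$$ A wall is a simplex $J\in K$ with $|J|=n-1$, and its class is $v_J=\prod_{i\in J}v_i\in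 H^{2n-2}(X_\Delta;\mathbb{R})$. Then the effective cone $$\mathrm{NE}(X_\Delta)=\Big\{\sum_{J} r_Jv_J\in H^{2n-2}(X_\Delta;\mathbb{R})\ \Big|\ r_J\ge 0\Big\},$$ where the sums run over all walls $J$, is a strictly convex polyhedral cone in $H^{2n-2}(X_\Delta;\mathbb{R})$: it is finitely generated and $\mathrm{NE}(X_\Delta)\cap(-\mathrm{NE}(X_\Delta))=\{0\}$. Moreover, $v_J\neq 0$ for every wall $J$. -/

import Mathlib

open scoped BigOperators

noncomputable section

/-- The image in `V = ℝⁿ` of a vector of the lattice `N = ℤⁿ`. -/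
def latticeVec {n : ℕ} (v : Fin n → ℤ) : Fin n → ℝ := fun k => (v k : ℝ)

/-- A complete unimodular fan `Δ` in `V = ℝⁿ` with lattice `N = ℤⁿ` and with `m` rays.
The rays are numbered by `[m] = Fin m`; `lam i` is the primitive generator of the `i`-th ray,
`K` is the underlying simplicial complex (it contains the empty simplex), and the cones of the
fan are the cones spanned by `lam i`, `i ∈ I`, for the simplices `I ∈ K`. -/
structure CompleteUnimodularFan (n m : ℕ) where
  /-- the characteristic function -/
  lam : Fin m → (Fin n → ℤ)
  /-- different indices give different rays -/
  lam_injective : Function.Injective lam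
  /-- the simplices of the underlying simplicial complex -/
  K : Set (Finset (Fin m))
  /-- `K` is a simplicial complex (a face of a cone of the fan is a cone of the fan) -/
  down_closed : ∀ I ∈ K, ∀ J, J ⊆ I → J ∈ K
  /-- each `i` indexes a ray of the fan -/
  singleton_mem : ∀ i, {i} ∈ K
  /-- each cone of the fan is generated by a part of a basis of the lattice -/
  unimodular : ∀ I ∈ K, ∃ b : Module.Basis (Fin n) ℤ (Fin n → ℤ), ∀ i ∈ I, lam i ∈ Set.range b
  /-- two cones of the fan intersect in a common face, spanned by the common generators -/
  inter : ∀ I ∈ K, ∀ J ∈ K,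
    PointedCone.hull ℝ ((fun i => latticeVec (lam i)) '' (I : Set (Fin m))) ⊓
      PointedCone.hull ℝ ((fun i => latticeVec (lam i)) '' (J : Set (Fin m))) =
    PointedCone.hull ℝ ((fun i => latticeVec (lam i)) '' ((I ∩ J : Finset (Fin m)) : Set (Fin m)))
  /-- the cones of the fan cover `ℝⁿ` -/
  complete : ∀ x : Fin n → ℝ, ∃ I ∈ K,
    x ∈ PointedCone.hull ℝ ((fun i => latticeVec (lam i)) '' (I : Set (Fin m)))

/-! ### Polytopes in the dual space and their normal fans

The dual space of `ℝⁿ` is identified with `ℝⁿ` by the pairing `⟨x, y⟩ = x ⬝ᵥ y`. -/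

/-- `P` is an `n`-dimensional convex polytope in `ℝⁿ`. -/
def IsFullDimPolytope {n : ℕ} (P : Set (Fin n → ℝ)) : Prop :=
  (∃ S : Set (Fin n → ℝ), S.Finite ∧ P = convexHull ℝ S) ∧ (interior P).Nonempty

/-- `F` is a nonempty face of the polytope `P` (the whole polytope is allowed). -/
def IsPolytopeFace {n : ℕ} (P F : Set (Fin n → ℝ)) : Prop :=
  F.Nonempty ∧ IsExposed ℝ P F

/-- `G` is a facet of `P`: a face of dimension `n - 1`. -/
def IsPolytopeFacet {n : ℕ} (P G : Set (Fin n → ℝ)) : Prop :=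
  IsPolytopeFace P G ∧ Module.finrank ℝ (vectorSpan ℝ G) + 1 = n

/-- `y` is an outward normal vector to the facet `G` of `P`. -/
def IsOutwardNormal {n : ℕ} (P G : Set (Fin n → ℝ)) (y : Fin n → ℝ) : Prop :=
  y ≠ 0 ∧ ∀ g ∈ G, ∀ x ∈ P, x ⬝ᵥ y ≤ g ⬝ᵥ y

/-- The cone spanned by the outward normal vectors to the facets of `P` that contain `F`. -/
def normalCone {n : ℕ} (P F : Set (Fin n → ℝ)) : PointedCone ℝ (Fin n → ℝ) :=
  PointedCone.hull ℝ {y | ∃ G, IsPolytopeFacet P G ∧ F ⊆ G ∧ IsOutwardNormal P G y}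

/-- The normal fan of `P`, as a collection of cones. -/
def normalFan {n : ℕ} (P : Set (Fin n → ℝ)) : Set (PointedCone ℝ (Fin n → ℝ)) :=
  {σ | ∃ F, IsPolytopeFace P F ∧ σ = normalCone P F}

namespace CompleteUnimodularFan

variable {n m : ℕ} (Δ : CompleteUnimodularFan n m)

/-- The cone spanned by `lam i`, `i ∈ I`. -/
def cone (I : Finset (Fin m)) : PointedCone ℝ (Fin n → ℝ) :=
  PointedCone.hull ℝ ((fun i => latticeVec (Δ.lam i)) '' (I : Set (Fin m)))

/-- The fan as a collection of cones. -/
def cones : Set (PointedCone ℝ (Fin n → ℝ)) :=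
  {σ | ∃ I ∈ Δ.K, σ = Δ.cone I}

/-- The fan is polytopal, i.e. the toric variety `X_Δ` is projective: `Δ` is the normal fan of
a convex polytope. -/
def IsPolytopal : Prop :=
  ∃ P : Set (Fin n → ℝ), IsFullDimPolytope P ∧ normalFan P = Δ.cones

/-! ### The cohomology ring, in the Danilov–Jurkiewicz description -/

/-- The Stanley–Reisner ideal of `K`. -/
def stanleyReisnerIdeal : Ideal (MvPolynomial (Fin m) ℝ) :=
  Ideal.span {p | ∃ I : Finset (Fin m), I ∉ Δ.K ∧ p = ∏ i ∈ I, MvPolynomial.X i}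

/-- The ideal generated by the linear forms `∑ ⟨μ, lam i⟩ v_i`, `μ : N → ℤ` linear. -/
def linearIdeal : Ideal (MvPolynomial (Fin m) ℝ) :=
  Ideal.span {p | ∃ μ : (Fin n → ℤ) →ₗ[ℤ] ℤ,
    p = ∑ i, MvPolynomial.C ((μ (Δ.lam i) : ℤ) : ℝ) * MvPolynomial.X i}

/-- The ring `H^*(X_Δ; ℝ) = ℝ[K] / Θ`, in which `v_i` has degree `2`. -/
abbrev Cohomology : Type :=
  MvPolynomial (Fin m) ℝ ⧸ (Δ.stanleyReisnerIdeal ⊔ Δ.linearIdeal)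

/-- The class `v_i ∈ H^2(X_Δ; ℝ)`. -/
def v (i : Fin m) : Δ.Cohomology :=
  Ideal.Quotient.mkₐ ℝ (Δ.stanleyReisnerIdeal ⊔ Δ.linearIdeal) (MvPolynomial.X i)

/-- The graded piece `H^{2k}(X_Δ; ℝ)`: the classes of the homogeneous polynomials of degree `k`
in the `v_i`. -/
def evenCohomology (k : ℕ) : Submodule ℝ Δ.Cohomology :=
  (MvPolynomial.homogeneousSubmodule (Fin m) ℝ k).map
    (Ideal.Quotient.mkₐ ℝ (Δ.stanleyReisnerIdeal ⊔ Δ.linearIdeal)).toLinearMap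

/-- A monomial `v_J` with `|J| = k` lies in `H^{2k}`. -/
theorem prod_v_mem (J : Finset (Fin m)) {k : ℕ} (hJ : J.card = k) :
    ∏ i ∈ J, Δ.v i ∈ Δ.evenCohomology k := by
  subst hJ
  refine Submodule.mem_map.2 ⟨∏ i ∈ J, MvPolynomial.X i, ?_, ?_⟩
  · rw [MvPolynomial.mem_homogeneousSubmodule]
    have h := MvPolynomial.IsHomogeneous.prod J
      (fun i => (MvPolynomial.X i : MvPolynomial (Fin m) ℝ)) (fun _ => 1)
      (fun i _ => MvPolynomial.isHomogeneous_X ℝ i)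
    simpa using h
  · rw [AlgHom.toLinearMap_apply, map_prod]
    rfl

/-- The walls: simplices `J ∈ K` with `n - 1` vertices (there are none if `n = 0`). -/
def Wall : Type := {J : Finset (Fin m) // J ∈ Δ.K ∧ J.card + 1 = n}

/-- The class `v_J ∈ H^{2n-2}(X_Δ; ℝ)` of a wall `J`, the product of the `v_i`, `i ∈ J`. -/
def wallClass (J : Δ.Wall) : Δ.evenCohomology (n - 1) :=
  ⟨∏ i ∈ J.1, Δ.v i, Δ.prod_v_mem J.1 (Nat.eq_sub_of_add_eq J.2.2)⟩

/-- The cone `NE(X_Δ)` of all combinations of the classes `v_J` with nonnegative real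
coefficients. -/
def effectiveCone : PointedCone ℝ (Δ.evenCohomology (n - 1)) :=
  PointedCone.hull ℝ (Set.range Δ.wallClass)

end CompleteUnimodularFan

end

/-!
An ample divisor `D` has positive intersection number with every torus-invariant curve, so
`x ↦ ∫ x D` is a linear form that is positive on the generators `v_J` of the effective cone. Such a
form forces the cone to be strictly convex and the `v_J` to be nonzero.

The integral comes from localization at the torus-fixed points, the maximal simplices `I`: for
generic `t` put `∫ f = ∑_I f|_I (t) / ∏_{i ∈ I} u_{I,i}(t)`, where `u_{I,i}` are the coordinates
with respect to the generators of the cone of `I` and `f|_I` substitutes them for the `v_i`. If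
`deg f < n`, expanding the summands in partial fractions along a generic line through `t` gives one
term for each pair `(I, i)`, that is, for each side `I` of a wall `I \ {i}`. By unimodularity the
transverse coordinates on the two sides of a wall are opposite, so the terms cancel and `∫ f = 0`.
Hence in degree `n` the integral annihilates the linear relations as well as the Stanley–Reisner
ideal, and it descends to cohomology.

If `D` is given by the vertices `p_I` of the polytope and `J = I ∩ I'` is a wall with transverse
coordinate `u` on the side of `I`, then `∫ v_J D = (p_I - p_{I'})(t) / u(t)`. This is the bend of
the support function across `J`, which is positive by strict convexity.
-/

noncomputable section

section PartialFractions

open Polynomial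

variable {k V ι : Type*} [Field k] [AddCommGroup V] [Module k V] {s : Finset ι}

theorem eval_div_prod_sub_eq_sum [DecidableEq ι] {v : ι → k} (hv : Set.InjOn v s) {x : k}
    (hx : ∀ i ∈ s, x ≠ v i) {p : k[X]} (hp : p.degree < s.card) :
    p.eval x / ∏ i ∈ s, (x - v i) =
      ∑ i ∈ s, p.eval (v i) / ((∏ j ∈ s.erase i, (v i - v j)) * (x - v i)) := by
  have hnodal : ∏ i ∈ s, (x - v i) ≠ 0 :=
    Finset.prod_ne_zero_iff.2 fun i hi => sub_ne_zero.2 (hx i hi)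
  rw [div_eq_iff hnodal]
  conv_lhs => rw [Lagrange.eq_interpolate hv hp, Lagrange.eval_interpolate_not_at_node _ hx,
    Lagrange.eval_nodal, mul_comm]
  congr 1
  refine Finset.sum_congr rfl fun i _ => ?_
  rw [Lagrange.nodalWeight, Finset.prod_inv_distrib, ← mul_inv, div_eq_inv_mul]

theorem eval_zero_div_prod_eq_sum [DecidableEq ι] {a b : ι → k} (ha : ∀ i ∈ s, a i ≠ 0)
    (hb : ∀ i ∈ s, b i ≠ 0) (hab : ∀ i ∈ s, ∀ j ∈ s, i ≠ j → a i * b j ≠ a j * b i) {p : k[X]}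
    (hp : p.degree < s.card) :
    p.eval 0 / ∏ i ∈ s, a i = ∑ i ∈ s, p.eval (-(a i / b i)) /
      ((∏ j ∈ s.erase i, (a j + -(a i / b i) * b j)) * a i) := by
  set v : ι → k := fun i => -(a i / b i) with hv
  have hinj : Set.InjOn v s := fun i hi j hj h => by
    by_contra hij
    exact hab i hi j hj hij ((div_eq_div_iff (hb i hi) (hb j hj)).1 (neg_injective h))
  have hne : ∀ i ∈ s, 0 ≠ v i := fun i hi =>
    (neg_ne_zero.2 (div_ne_zero (ha i hi) (hb i hi))).symm
  have hfactor : ∀ j ∈ s, ∀ r, a j + r * b j = b j * (r - v j) := fun j hj r => by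
    have := hb j hj
    simp only [hv]
    field_simp
    ring
  have hzero : ∀ j ∈ s, a j = b j * (0 - v j) := fun j hj => by
    rw [← hfactor j hj, zero_mul, add_zero]
  rw [Finset.prod_congr rfl hzero, Finset.prod_mul_distrib, ← div_div, div_right_comm,
    eval_div_prod_sub_eq_sum hinj hne hp, Finset.sum_div]
  refine Finset.sum_congr rfl fun i hi => ?_
  have hprod : ∏ j ∈ s.erase i, (a j + v i * b j) =
      (∏ j ∈ s.erase i, b j) * ∏ j ∈ s.erase i, (v i - v j) := by
    rw [← Finset.prod_mul_distrib]
    exact Finset.prod_congr rfl fun j hj => hfactor j (Finset.mem_of_mem_erase hj) _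
  change _ = p.eval (v i) / ((∏ j ∈ s.erase i, (a j + v i * b j)) * a i)
  rw [hprod, hzero i hi, div_div, ← Finset.prod_erase_mul s _ hi]
  ring

theorem exists_polynomial_eval_eq_aeval_line (a b : ι → k) (f : MvPolynomial ι k) :
    ∃ p : k[X], p.natDegree ≤ f.totalDegree ∧
      ∀ r, p.eval r = MvPolynomial.aeval (fun i => a i + r * b i) f := by
  refine ⟨MvPolynomial.aeval (fun i => C (a i) + C (b i) * X) f, ?_, fun r => ?_⟩
  · simpa using MvPolynomial.aeval_natDegree_le f le_rfl _ (n := 1) fun i => by compute_degree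
  · have hcomp : (Polynomial.aeval r).comp (MvPolynomial.aeval fun i => C (a i) + C (b i) * X) =
        MvPolynomial.aeval fun i => a i + r * b i := by
      ext i
      simp [mul_comm r]
    rw [← hcomp, AlgHom.comp_apply, Polynomial.coe_aeval_eq_eval]

/-- The point where the line through `t` in direction `w` meets the hyperplane `ℓ = 0`. It is
meaningful only if `ℓ w ≠ 0`. -/
def kerPoint (ℓ : Module.Dual k V) (w t : V) : V := t - (ℓ t / ℓ w) • w

theorem apply_kerPoint_self {ℓ : Module.Dual k V} {w : V} (hw : ℓ w ≠ 0) (t : V) :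
    ℓ (kerPoint ℓ w t) = 0 := by
  rw [kerPoint, map_sub, map_smul, smul_eq_mul, div_mul_cancel₀ _ hw, sub_self]

theorem kerPoint_neg (ℓ : Module.Dual k V) (w t : V) : kerPoint (-ℓ) w t = kerPoint ℓ w t := by
  simp only [kerPoint, LinearMap.neg_apply, neg_div_neg_eq]

/-- Along the line `t + r w` this is the partial fraction decomposition of a rational function of
`r` of negative degree with simple poles, evaluated at `r = 0`. -/
theorem aeval_div_prod_eq_sum [DecidableEq ι] (ℓ : ι → Module.Dual k V) {f : MvPolynomial ι k}
    (hf : f.totalDegree < s.card) {t w : V} (ht : ∀ i ∈ s, ℓ i t ≠ 0) (hw : ∀ i ∈ s, ℓ i w ≠ 0)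
    (htw : ∀ i ∈ s, ∀ j ∈ s, i ≠ j → ℓ i t * ℓ j w ≠ ℓ j t * ℓ i w) :
    MvPolynomial.aeval (fun i => ℓ i t) f / ∏ i ∈ s, ℓ i t =
      ∑ i ∈ s, MvPolynomial.aeval (fun j => ℓ j (kerPoint (ℓ i) w t)) f /
        ((∏ j ∈ s.erase i, ℓ j (kerPoint (ℓ i) w t)) * ℓ i t) := by
  obtain ⟨p, hpdeg, hp⟩ :=
    exists_polynomial_eval_eq_aeval_line (fun i => ℓ i t) (fun i => ℓ i w) f
  have hdeg : p.degree < s.card :=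
    degree_le_natDegree.trans_lt (by exact_mod_cast hpdeg.trans_lt hf)
  have hpoint : ∀ i j, ℓ j (kerPoint (ℓ i) w t) = ℓ j t + -(ℓ i t / ℓ i w) * ℓ j w :=
    fun i j => by rw [kerPoint, map_sub, map_smul, smul_eq_mul, sub_eq_add_neg, neg_mul]
  have hzero : p.eval 0 = MvPolynomial.aeval (fun i => ℓ i t) f := by
    simp only [hp, zero_mul, add_zero]
  simp only [← hzero, hpoint, ← hp]
  exact eval_zero_div_prod_eq_sum ht hw htw hdeg

end PartialFractions

section Polynomials

theorem map_eq_zero_of_mem_ideal_span {R A M : Type*} [CommSemiring R] [CommSemiring A]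
    [Algebra R A] [AddCommMonoid M] [Module R M] (φ : A →ₗ[R] M) {S : Set A}
    (hS : ∀ g, ∀ p ∈ S, φ (g * p) = 0) {f : A} (hf : f ∈ Ideal.span S) : φ f = 0 := by
  induction hf using Submodule.closure_induction with
  | zero => exact map_zero φ
  | add x y _ _ hx hy => rw [map_add, hx, hy, add_zero]
  | smul_mem g p hp => exact hS g p hp

theorem homogeneousComponent_mul_of_isHomogeneous {σ R : Type*} [CommSemiring R]
    {p : MvPolynomial σ R} {d : ℕ} (hp : p.IsHomogeneous d) (g : MvPolynomial σ R) (k : ℕ) :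
    MvPolynomial.homogeneousComponent k (g * p) =
      if d ≤ k then MvPolynomial.homogeneousComponent (k - d) g * p else 0 := by
  let _ := MvPolynomial.gradedAlgebra (σ := σ) (R := R)
  have hdecompose : ∀ f j, (DirectSum.decompose (MvPolynomial.homogeneousSubmodule σ R) f j :
      MvPolynomial σ R) = MvPolynomial.homogeneousComponent j f :=
    MvPolynomial.decomposition.decompose'_apply
  simpa only [hdecompose] using
    DirectSum.coe_decompose_mul_of_right_mem (MvPolynomial.homogeneousSubmodule σ R) k
      (a := g) ((MvPolynomial.mem_homogeneousSubmodule _ _).2 hp)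

theorem isHomogeneous_prod_X {σ R : Type*} [CommSemiring R] (J : Finset σ) :
    (∏ i ∈ J, (MvPolynomial.X i : MvPolynomial σ R)).IsHomogeneous J.card := by
  simpa using MvPolynomial.IsHomogeneous.prod J
    (fun i => (MvPolynomial.X i : MvPolynomial σ R)) (fun _ => 1)
    (fun i _ => MvPolynomial.isHomogeneous_X R i)

end Polynomials

section Cones

variable {𝕜 E : Type*} [Field 𝕜] [LinearOrder 𝕜] [IsStrictOrderedRing 𝕜] [AddCommGroup E]
  [Module 𝕜 E] {s : Set E} {ψ : Module.Dual 𝕜 E}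

theorem eq_zero_or_pos_of_mem_hull (hψ : ∀ x ∈ s, 0 < ψ x) {x : E}
    (hx : x ∈ PointedCone.hull 𝕜 s) : x = 0 ∨ 0 < ψ x := by
  obtain ⟨c, hcs, hc, rfl⟩ := PointedCone.mem_hull_set.1 hx
  refine or_iff_not_imp_left.2 fun hne => ?_
  obtain ⟨y, hy⟩ : c.support.Nonempty := by
    rw [Finsupp.support_nonempty_iff]
    rintro rfl
    exact hne Finsupp.sum_zero_index
  rw [Finsupp.sum, map_sum]
  refine Finset.sum_pos (fun z hz => ?_) ⟨y, hy⟩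
  rw [map_smul]
  exact mul_pos ((hc z).lt_of_ne' (Finsupp.mem_support_iff.1 hz)) (hψ z (hcs hz))

theorem salient_hull_of_pos (hψ : ∀ x ∈ s, 0 < ψ x) :
    (PointedCone.hull 𝕜 s : ConvexCone 𝕜 E).Salient := fun x hx hx0 hnx => by
  have hpos := (eq_zero_or_pos_of_mem_hull hψ hx).resolve_left hx0
  have hneg := (eq_zero_or_pos_of_mem_hull hψ hnx).resolve_left (neg_ne_zero.2 hx0)
  rw [map_neg] at hneg
  exact hpos.not_gt (neg_pos.1 hneg)

theorem isMaxOn_dotProduct_of_mem_normalCone {n : ℕ} {P F : Set (Fin n → ℝ)} {y : Fin n → ℝ}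
    (hy : y ∈ normalCone P F) {q : Fin n → ℝ} (hq : q ∈ F) : IsMaxOn (· ⬝ᵥ y) P q := by
  intro x hx
  have hle : normalCone P F ≤
      (PointedCone.positive ℝ ℝ).comap (dotProductEquiv ℝ (Fin n) (q - x)) := by
    refine Submodule.span_le.2 ?_
    rintro z ⟨G, -, hFG, -, hmax⟩
    exact (sub_nonneg.2 (hmax q (hFG hq) x hx)).trans_eq (sub_dotProduct q x z).symm
  have hpos : 0 ≤ (q - x) ⬝ᵥ y := hle hy
  rwa [sub_dotProduct, sub_nonneg] at hpos

end Cones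

/-- The real-linear extension of an integral linear form. -/
def realExtension {n : ℕ} (μ : (Fin n → ℤ) →ₗ[ℤ] ℤ) : Module.Dual ℝ (Fin n → ℝ) :=
  dotProductEquiv ℝ (Fin n) fun k => ((μ (Pi.single k 1) : ℤ) : ℝ)

theorem realExtension_latticeVec {n : ℕ} (μ : (Fin n → ℤ) →ₗ[ℤ] ℤ) (v : Fin n → ℤ) :
    realExtension μ (latticeVec v) = (μ v : ℤ) := by
  have hμ : μ v = (fun k => μ (Pi.single k 1)) ⬝ᵥ v := by
    conv_lhs => rw [pi_eq_sum_univ' v, map_sum]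
    exact Finset.sum_congr rfl fun k _ => by rw [map_smul, smul_eq_mul, mul_comm]
  rw [hμ]
  simp [realExtension, latticeVec, dotProduct]

namespace CompleteUnimodularFan

variable {n m : ℕ}

section Coordinates

variable (Δ : CompleteUnimodularFan n m) {I J : Finset (Fin m)} {i j : Fin m}

/-- The primitive generator of the `i`-th ray, as a real vector. -/
def vec (i : Fin m) : Fin n → ℝ := latticeVec (Δ.lam i)

/-- The linear span of the cone of `I`. -/
def linSpan (I : Finset (Fin m)) : Submodule ℝ (Fin n → ℝ) :=
  Submodule.span ℝ (Δ.vec '' I)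

open Classical in
/-- The coordinate of a vector along `vec i` with respect to the generators of the cone of `I`,
extended by zero to the indices `i ∉ I` and the sets `I ∉ K`. Its values outside `linSpan I` depend
on the choice of a lattice basis containing the generators. -/
def coord (I : Finset (Fin m)) (i : Fin m) : Module.Dual ℝ (Fin n → ℝ) :=
  if h : I ∈ Δ.K ∧ i ∈ I then
    realExtension ((Δ.unimodular I h.1).choose.coord
      ((Δ.unimodular I h.1).choose_spec i h.2).choose)
  else 0

variable {Δ}

theorem coord_of_notMem (hi : i ∉ I) : Δ.coord I i = 0 := dif_neg fun h => hi h.2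

theorem coord_vec (hI : I ∈ Δ.K) (hj : j ∈ I) :
    Δ.coord I i (Δ.vec j) = if i = j then 1 else 0 := by
  by_cases hi : i ∈ I
  · have hspec := (Δ.unimodular I hI).choose_spec
    rw [coord, dif_pos ⟨hI, hi⟩, vec, realExtension_latticeVec, ← (hspec j hj).choose_spec,
      Module.Basis.coord_apply, Module.Basis.repr_self, Finsupp.single_apply, Int.cast_ite,
      Int.cast_one, Int.cast_zero]
    refine if_congr ⟨fun h => Δ.lam_injective ?_, ?_⟩ rfl rfl
    · rw [← (hspec i hi).choose_spec, ← (hspec j hj).choose_spec, h]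
    · rintro rfl
      rfl
  · rw [coord_of_notMem hi, if_neg (ne_of_mem_of_not_mem hj hi).symm, LinearMap.zero_apply]

theorem coord_vec_self (hI : I ∈ Δ.K) (hi : i ∈ I) : Δ.coord I i (Δ.vec i) = 1 := by
  rw [coord_vec hI hi, if_pos rfl]

theorem coord_ne_zero (hI : I ∈ Δ.K) (hi : i ∈ I) : Δ.coord I i ≠ 0 := fun h => by
  simpa [h] using coord_vec_self hI hi

variable (Δ) in
theorem exists_int_coord_vec (I : Finset (Fin m)) (i j : Fin m) :
    ∃ z : ℤ, Δ.coord I i (Δ.vec j) = z := by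
  rw [coord, vec]
  split_ifs
  · exact ⟨_, realExtension_latticeVec _ _⟩
  · exact ⟨0, by rw [LinearMap.zero_apply, Int.cast_zero]⟩

theorem vec_mem_linSpan (hi : i ∈ I) : Δ.vec i ∈ Δ.linSpan I :=
  Submodule.subset_span ⟨i, hi, rfl⟩

theorem vec_mem_cone (hi : i ∈ I) : Δ.vec i ∈ Δ.cone I :=
  PointedCone.subset_hull ⟨i, hi, rfl⟩

theorem sum_smul_mem_cone {c : Fin m → ℝ} (hc : ∀ i ∈ I, 0 ≤ c i) :
    ∑ i ∈ I, c i • Δ.vec i ∈ Δ.cone I :=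
  Submodule.sum_mem _ fun i hi => PointedCone.smul_mem _ (hc i hi) (vec_mem_cone hi)

theorem sum_vec_mem_cone : ∑ i ∈ I, Δ.vec i ∈ Δ.cone I :=
  Submodule.sum_mem _ fun _ hi => vec_mem_cone hi

theorem cone_mono (h : I ⊆ J) : Δ.cone I ≤ Δ.cone J :=
  Submodule.span_mono (Set.image_mono h)

theorem mem_linSpan_of_mem_cone {x : Fin n → ℝ} (hx : x ∈ Δ.cone I) : x ∈ Δ.linSpan I :=
  PointedCone.hull_le_span ℝ (Δ.vec '' I) hx

theorem sum_coord_smul_of_mem_linSpan (hI : I ∈ Δ.K) {x : Fin n → ℝ} (hx : x ∈ Δ.linSpan I) :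
    ∑ i ∈ I, Δ.coord I i x • Δ.vec i = x := by
  let proj : Module.End ℝ (Fin n → ℝ) := ∑ i ∈ I, (Δ.coord I i).smulRight (Δ.vec i)
  have heq : Set.EqOn proj (LinearMap.id : Module.End ℝ (Fin n → ℝ)) (Δ.vec '' I) := by
    rintro _ ⟨j, hj, rfl⟩
    simp [proj, coord_vec hI (Finset.mem_coe.1 hj), Finset.mem_coe.1 hj]
  simpa [proj] using LinearMap.eqOn_span heq hx

theorem coord_eq_coord_of_mem_linSpan (hI : I ∈ Δ.K) (hJ : J ⊆ I) (i : Fin m)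
    {x : Fin n → ℝ} (hx : x ∈ Δ.linSpan J) : Δ.coord I i x = Δ.coord J i x := by
  have heq : Set.EqOn (Δ.coord I i) (Δ.coord J i) (Δ.vec '' J) := by
    rintro _ ⟨j, hj, rfl⟩
    rw [coord_vec hI (hJ hj), coord_vec (Δ.down_closed I hI J hJ) hj]
  exact LinearMap.eqOn_span heq hx

theorem coord_eq_zero_of_mem_linSpan (hI : I ∈ Δ.K) (hJ : J ⊆ I) (hi : i ∉ J)
    {x : Fin n → ℝ} (hx : x ∈ Δ.linSpan J) : Δ.coord I i x = 0 := by
  rw [coord_eq_coord_of_mem_linSpan hI hJ i hx, coord_of_notMem hi, LinearMap.zero_apply]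

theorem vec_notMem_linSpan (hi : i ∉ J) (h : insert i J ∈ Δ.K) : Δ.vec i ∉ Δ.linSpan J :=
  fun hx => zero_ne_one <|
    (coord_eq_zero_of_mem_linSpan h (Finset.subset_insert i J) hi hx).symm.trans
      (coord_vec_self h (Finset.mem_insert_self i J))

theorem linearIndependent_vec (hI : I ∈ Δ.K) : LinearIndependent ℝ fun i : I => Δ.vec i := by
  refine Fintype.linearIndependent_iff.2 fun g hg i => ?_
  simpa [coord_vec hI (Subtype.coe_prop _)] using congrArg (Δ.coord I i) hg

theorem card_le (hI : I ∈ Δ.K) : I.card ≤ n := by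
  simpa using (linearIndependent_vec hI).fintype_card_le_finrank

theorem linSpan_eq_top (hI : I ∈ Δ.K) (hn : I.card = n) : Δ.linSpan I = ⊤ := by
  rw [linSpan, Set.image_eq_range]
  exact (linearIndependent_vec hI).span_eq_top_of_card_eq_finrank' (by simp [hn])

theorem mem_cone_iff (hI : I ∈ Δ.K) {x : Fin n → ℝ} :
    x ∈ Δ.cone I ↔ x ∈ Δ.linSpan I ∧ ∀ i ∈ I, 0 ≤ Δ.coord I i x := by
  refine ⟨fun hx => ⟨mem_linSpan_of_mem_cone hx, fun i _ => ?_⟩, fun ⟨hx, h0⟩ => ?_⟩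
  · have hle : Δ.cone I ≤ (PointedCone.positive ℝ ℝ).comap (Δ.coord I i) := by
      refine Submodule.span_le.2 ?_
      rintro _ ⟨j, hj, rfl⟩
      refine le_of_le_of_eq ?_ (coord_vec hI hj).symm
      split_ifs <;> norm_num
    exact hle hx
  · rw [← sum_coord_smul_of_mem_linSpan hI hx]
    exact sum_smul_mem_cone h0

theorem isClosed_cone (hI : I ∈ Δ.K) : IsClosed (Δ.cone I : Set (Fin n → ℝ)) := by
  have hset : (Δ.cone I : Set (Fin n → ℝ)) =
      (Δ.linSpan I : Set (Fin n → ℝ)) ∩ ⋂ i ∈ I, {x | 0 ≤ Δ.coord I i x} := by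
    ext x
    simp [mem_cone_iff hI]
  rw [hset]
  exact (Submodule.closed_of_finiteDimensional _).inter <| isClosed_biInter fun i _ =>
    isClosed_le continuous_const (LinearMap.continuous_of_finiteDimensional _)

theorem subset_of_sum_vec_mem_cone (hI : I ∈ Δ.K) (hJ : J ∈ Δ.K)
    (h : ∑ j ∈ J, Δ.vec j ∈ Δ.cone I) : J ⊆ I := fun j hj => by
  have hinter : ∑ j ∈ J, Δ.vec j ∈ Δ.cone (I ∩ J) :=
    (Δ.inter I hI J hJ).le ⟨h, sum_vec_mem_cone⟩
  by_contra hjI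
  have hzero : Δ.coord J j (∑ k ∈ J, Δ.vec k) = 0 :=
    coord_eq_zero_of_mem_linSpan hJ Finset.inter_subset_right (by simp [hjI])
      (mem_linSpan_of_mem_cone hinter)
  rw [map_sum, Finset.sum_congr rfl fun k hk => coord_vec hJ hk, Finset.sum_ite_eq,
    if_pos hj] at hzero
  exact one_ne_zero hzero

variable (Δ) in
theorem cone_injOn : Set.InjOn Δ.cone Δ.K := fun _ hI _ hJ h =>
  (subset_of_sum_vec_mem_cone hJ hI (h ▸ sum_vec_mem_cone)).antisymm
    (subset_of_sum_vec_mem_cone hI hJ (h ▸ sum_vec_mem_cone))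

end Coordinates

section MaximalSimplices

variable (Δ : CompleteUnimodularFan n m) {I : Finset (Fin m)}

open Classical in
/-- The simplices of the maximal cones of the fan, i.e. the torus-fixed points of `X_Δ`. -/
def maxSimplices : Finset (Finset (Fin m)) := {I | I ∈ Δ.K ∧ I.card = n}

variable {Δ}

theorem mem_maxSimplices : I ∈ Δ.maxSimplices ↔ I ∈ Δ.K ∧ I.card = n := by
  simp [maxSimplices]

theorem mem_K_of_mem_maxSimplices (hI : I ∈ Δ.maxSimplices) : I ∈ Δ.K :=
  (mem_maxSimplices.1 hI).1

theorem mem_linSpan_of_mem_maxSimplices (hI : I ∈ Δ.maxSimplices) (x : Fin n → ℝ) :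
    x ∈ Δ.linSpan I := by
  obtain ⟨hIK, hIn⟩ := mem_maxSimplices.1 hI
  rw [linSpan_eq_top hIK hIn]
  exact Submodule.mem_top

theorem sum_coord_smul (hI : I ∈ Δ.maxSimplices) (x : Fin n → ℝ) :
    ∑ i ∈ I, Δ.coord I i x • Δ.vec i = x :=
  sum_coord_smul_of_mem_linSpan (mem_K_of_mem_maxSimplices hI)
    (mem_linSpan_of_mem_maxSimplices hI x)

theorem dual_ext (hI : I ∈ Δ.maxSimplices) {ℓ ℓ' : Module.Dual ℝ (Fin n → ℝ)}
    (h : ∀ i ∈ I, ℓ (Δ.vec i) = ℓ' (Δ.vec i)) : ℓ = ℓ' :=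
  LinearMap.ext fun x => LinearMap.eqOn_span (Set.forall_mem_image.2 h)
    (mem_linSpan_of_mem_maxSimplices hI x)

end MaximalSimplices

section Walls

variable (Δ : CompleteUnimodularFan n m) {I J : Finset (Fin m)} {a b i : Fin m}

open Classical in
/-- The simplices with `n - 1` vertices, as a finite set: the underlying simplices of the walls. -/
def wallSimplices : Finset (Finset (Fin m)) := {J | J ∈ Δ.K ∧ J.card + 1 = n}

open Classical in
/-- The vertices of the link of `J` in `K`. -/
def linkVertices (J : Finset (Fin m)) : Finset (Fin m) := {i | i ∉ J ∧ insert i J ∈ Δ.K}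

variable {Δ}

theorem mem_wallSimplices : J ∈ Δ.wallSimplices ↔ J ∈ Δ.K ∧ J.card + 1 = n := by
  simp [wallSimplices]

theorem mem_linkVertices : i ∈ Δ.linkVertices J ↔ i ∉ J ∧ insert i J ∈ Δ.K := by
  simp [linkVertices]

theorem insert_mem_maxSimplices (hJ : J ∈ Δ.wallSimplices) (hi : i ∈ Δ.linkVertices J) :
    insert i J ∈ Δ.maxSimplices := by
  obtain ⟨hiJ, hK⟩ := mem_linkVertices.1 hi
  exact mem_maxSimplices.2
    ⟨hK, (Finset.card_insert_of_notMem hiJ).trans (mem_wallSimplices.1 hJ).2⟩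

theorem erase_mem_wallSimplices (hI : I ∈ Δ.maxSimplices) (hi : i ∈ I) :
    I.erase i ∈ Δ.wallSimplices ∧ i ∈ Δ.linkVertices (I.erase i) := by
  obtain ⟨hIK, hIn⟩ := mem_maxSimplices.1 hI
  refine ⟨mem_wallSimplices.2 ⟨Δ.down_closed I hIK _ (Finset.erase_subset i I), ?_⟩,
    mem_linkVertices.2 ⟨Finset.notMem_erase i I, ?_⟩⟩
  · rw [Finset.card_erase_add_one hi, hIn]
  · rwa [Finset.insert_erase hi]

theorem exists_linkVertices_insert_eq (hJ : J ∈ Δ.wallSimplices) (hI : I ∈ Δ.K) (hJI : J ⊂ I) :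
    ∃ i ∈ Δ.linkVertices J, insert i J = I := by
  obtain ⟨i, hiI, hiJ⟩ := Finset.exists_of_ssubset hJI
  have heq : insert i J = I := by
    refine Finset.eq_of_subset_of_card_le (Finset.insert_subset hiI hJI.subset) ?_
    rw [Finset.card_insert_of_notMem hiJ, (mem_wallSimplices.1 hJ).2]
    exact card_le hI
  exact ⟨i, mem_linkVertices.2 ⟨hiJ, heq ▸ hI⟩, heq⟩

theorem coord_insert_eq_zero_iff (hJ : J ∈ Δ.wallSimplices) (hi : i ∈ Δ.linkVertices J)
    {x : Fin n → ℝ} : Δ.coord (insert i J) i x = 0 ↔ x ∈ Δ.linSpan J := by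
  obtain ⟨hiJ, hK⟩ := mem_linkVertices.1 hi
  refine ⟨fun h0 => ?_, coord_eq_zero_of_mem_linSpan hK (Finset.subset_insert i J) hiJ⟩
  rw [← sum_coord_smul (insert_mem_maxSimplices hJ hi) x, Finset.sum_insert hiJ, h0, zero_smul,
    zero_add]
  exact Submodule.sum_mem _ fun j hj => Submodule.smul_mem _ _ (vec_mem_linSpan hj)

open Topology in
theorem exists_superset_mem_cone (hJ : J ∈ Δ.K) (w : Fin n → ℝ) :
    ∃ I ∈ Δ.K, J ⊆ I ∧ ∃ ε : ℝ, 0 < ε ∧ ∑ j ∈ J, Δ.vec j + ε • w ∈ Δ.cone I := by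
  set y := ∑ j ∈ J, Δ.vec j
  have hnear : ∀ᶠ x in 𝓝 y, ∀ I, I ∈ Δ.K → x ∈ Δ.cone I → J ⊆ I := by
    refine Filter.eventually_all.2 fun I => ?_
    by_cases hyI : I ∈ Δ.K ∧ y ∉ Δ.cone I
    · filter_upwards [(isClosed_cone hyI.1).isOpen_compl.mem_nhds hyI.2] with x hx _ hxI
      exact absurd hxI hx
    · exact .of_forall fun x hI _ =>
        subset_of_sum_vec_mem_cone hI hJ (not_not.1 fun hyc => hyI ⟨hI, hyc⟩)
  have hlim : Filter.Tendsto (fun ε : ℝ => y + ε • w) (𝓝[>] 0) (𝓝 y) :=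
    (Continuous.tendsto' (by fun_prop) 0 y (by simp)).mono_left nhdsWithin_le_nhds
  obtain ⟨ε, hsub, hε⟩ := ((hlim.eventually hnear).and self_mem_nhdsWithin).exists
  obtain ⟨I, hI, hmem⟩ := Δ.complete (y + ε • w)
  exact ⟨I, hI, hsub I hI hmem, ε, hε, hmem⟩

theorem exists_linkVertices_coord_pos (hJ : J ∈ Δ.wallSimplices) {w : Fin n → ℝ}
    (hw : w ∉ Δ.linSpan J) : ∃ i ∈ Δ.linkVertices J, 0 < Δ.coord (insert i J) i w := by
  obtain ⟨I, hI, hJI, ε, hε, hmem⟩ := exists_superset_mem_cone (mem_wallSimplices.1 hJ).1 w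
  have hsum : ∑ j ∈ J, Δ.vec j ∈ Δ.linSpan J := Submodule.sum_mem _ fun _ => vec_mem_linSpan
  have hne : J ≠ I := by
    rintro rfl
    exact hw <| (Submodule.smul_mem_iff _ hε.ne').1 <|
      (Submodule.add_mem_iff_right _ hsum).1 (mem_linSpan_of_mem_cone hmem)
  obtain ⟨i, hi, rfl⟩ := exists_linkVertices_insert_eq hJ hI (hJI.ssubset_of_ne hne)
  have hnonneg := ((mem_cone_iff hI).1 hmem).2 i (Finset.mem_insert_self i J)
  rw [map_add, (coord_insert_eq_zero_iff hJ hi).2 hsum, zero_add, map_smul, smul_eq_mul] at hnonneg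
  exact ⟨i, hi, (nonneg_of_mul_nonneg_right hnonneg hε).lt_of_ne'
    fun h => hw ((coord_insert_eq_zero_iff hJ hi).1 h)⟩

/-- If two maximal cones through a wall were on the same side of it, they would intersect outside
the wall. -/
theorem coord_insert_vec_nonpos (hJ : J ∈ Δ.wallSimplices) (ha : a ∈ Δ.linkVertices J)
    (hb : b ∈ Δ.linkVertices J) (hab : a ≠ b) : Δ.coord (insert b J) b (Δ.vec a) ≤ 0 := by
  by_contra! hpos
  obtain ⟨haJ, hA⟩ := mem_linkVertices.1 ha
  obtain ⟨hbJ, hB⟩ := mem_linkVertices.1 hb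
  set c : Fin m → ℝ := fun j => |Δ.coord (insert b J) j (Δ.vec a)|
  set z := ∑ j ∈ J, c j • Δ.vec j with hz
  have hzJ : z ∈ Δ.cone J := sum_smul_mem_cone fun j _ => abs_nonneg _
  have hxA : Δ.vec a + z ∈ Δ.cone (insert a J) :=
    add_mem (vec_mem_cone (Finset.mem_insert_self a J)) (cone_mono (Finset.subset_insert a J) hzJ)
  have hxB : Δ.vec a + z ∈ Δ.cone (insert b J) := by
    refine (mem_cone_iff hB).2
      ⟨mem_linSpan_of_mem_maxSimplices (insert_mem_maxSimplices hJ hb) _, fun i hi => ?_⟩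
    rw [map_add]
    rcases Finset.mem_insert.1 hi with rfl | hiJ
    · rw [coord_eq_zero_of_mem_linSpan hB (Finset.subset_insert i J) hbJ
        (mem_linSpan_of_mem_cone hzJ), add_zero]
      exact hpos.le
    · have hzi : Δ.coord (insert b J) i z = c i := by
        rw [hz, map_sum, Finset.sum_congr rfl fun j hj => by
          rw [map_smul, coord_vec hB (Finset.mem_insert_of_mem hj), smul_eq_mul, mul_ite, mul_one,
            mul_zero], Finset.sum_ite_eq, if_pos hiJ]
      rw [hzi]
      linarith [neg_abs_le (Δ.coord (insert b J) i (Δ.vec a))]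
  have hinter : insert a J ∩ insert b J = J := by
    grind
  have hxJ : Δ.vec a + z ∈ Δ.cone J := hinter ▸ (Δ.inter _ hA _ hB).le ⟨hxA, hxB⟩
  exact vec_notMem_linSpan haJ hA <| (Submodule.add_mem_iff_left _ (mem_linSpan_of_mem_cone hzJ)).1
    (mem_linSpan_of_mem_cone hxJ)

theorem eq_smul_coord_insert (hJ : J ∈ Δ.wallSimplices) (ha : a ∈ Δ.linkVertices J)
    {ℓ : Module.Dual ℝ (Fin n → ℝ)} (hℓ : ∀ j ∈ J, ℓ (Δ.vec j) = 0) :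
    ℓ = ℓ (Δ.vec a) • Δ.coord (insert a J) a := by
  obtain ⟨haJ, hA⟩ := mem_linkVertices.1 ha
  refine dual_ext (insert_mem_maxSimplices hJ ha) fun j hj => ?_
  rw [LinearMap.smul_apply, coord_vec hA hj, smul_eq_mul]
  rcases Finset.mem_insert.1 hj with rfl | hjJ
  · rw [if_pos rfl, mul_one]
  · rw [if_neg (ne_of_mem_of_not_mem hjJ haJ).symm, mul_zero, hℓ j hjJ]

theorem coord_insert_eq_neg (hJ : J ∈ Δ.wallSimplices) (ha : a ∈ Δ.linkVertices J)
    (hb : b ∈ Δ.linkVertices J) (hab : a ≠ b) :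
    Δ.coord (insert b J) b = -Δ.coord (insert a J) a := by
  have hvanish : ∀ i ∈ Δ.linkVertices J, ∀ j ∈ J, Δ.coord (insert i J) i (Δ.vec j) = 0 :=
    fun i hi j hj => (coord_insert_eq_zero_iff hJ hi).2 (vec_mem_linSpan hj)
  have hBA := eq_smul_coord_insert hJ ha (hvanish b hb)
  have hAB := eq_smul_coord_insert hJ hb (hvanish a ha)
  obtain ⟨c, hc⟩ := Δ.exists_int_coord_vec (insert b J) b a
  obtain ⟨d, hd⟩ := Δ.exists_int_coord_vec (insert a J) a b
  have hcd : c * d = 1 := by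
    have hone := LinearMap.congr_fun hAB (Δ.vec a)
    rw [coord_vec_self (mem_linkVertices.1 ha).2 (Finset.mem_insert_self a J),
      LinearMap.smul_apply, smul_eq_mul, hc, hd, mul_comm] at hone
    exact_mod_cast hone.symm
  have hc0 : c ≤ 0 := by exact_mod_cast hc ▸ coord_insert_vec_nonpos hJ ha hb hab
  obtain rfl : c = -1 := (Int.eq_one_or_neg_one_of_mul_eq_one hcd).resolve_left (by omega)
  refine LinearMap.ext fun x => ?_
  rw [hBA, hc, LinearMap.smul_apply, LinearMap.neg_apply, smul_eq_mul, Int.cast_neg, Int.cast_one,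
    neg_one_mul]

theorem card_linkVertices (hJ : J ∈ Δ.wallSimplices) : (Δ.linkVertices J).card = 2 := by
  have hJn := (mem_wallSimplices.1 hJ).2
  have hne_top : Δ.linSpan J ≠ ⊤ := fun htop => by
    have hle := finrank_range_le_card (R := ℝ) fun j : J => Δ.vec j
    have hspan : Δ.linSpan J = Submodule.span ℝ (Set.range fun j : J => Δ.vec j) := by
      rw [linSpan, Set.image_eq_range]
      rfl
    rw [Set.finrank, ← hspan, htop, finrank_top,
      Module.finrank_fin_fun, Fintype.card_coe] at hle
    omega
  obtain ⟨w, hw⟩ : ∃ w, w ∉ Δ.linSpan J := by simpa [Submodule.eq_top_iff'] using hne_top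
  obtain ⟨a, ha, -⟩ := exists_linkVertices_coord_pos hJ hw
  obtain ⟨haJ, hA⟩ := mem_linkVertices.1 ha
  obtain ⟨b, hb, hpos⟩ := exists_linkVertices_coord_pos hJ (w := -Δ.vec a)
    (by simpa using vec_notMem_linSpan haJ hA)
  have hab : a ≠ b := by
    rintro rfl
    rw [map_neg, coord_vec_self hA (Finset.mem_insert_self a J)] at hpos
    linarith
  refine Finset.card_eq_two.2 ⟨a, b, hab, Finset.Subset.antisymm (fun i hi => ?_)
    (Finset.insert_subset ha (Finset.singleton_subset_iff.2 hb))⟩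
  by_contra hiab
  obtain ⟨hia, hib⟩ : i ≠ a ∧ i ≠ b := by simpa using hiab
  have hneg : Δ.coord (insert a J) a = -Δ.coord (insert a J) a :=
    calc Δ.coord (insert a J) a = -Δ.coord (insert i J) i := coord_insert_eq_neg hJ hi ha hia
      _ = Δ.coord (insert b J) b := (coord_insert_eq_neg hJ hi hb hib).symm
      _ = -Δ.coord (insert a J) a := coord_insert_eq_neg hJ ha hb hab
  have hone := LinearMap.congr_fun hneg (Δ.vec a)
  rw [LinearMap.neg_apply, coord_vec_self hA (Finset.mem_insert_self a J)] at hone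
  norm_num at hone

theorem sum_maxSimplices_eq_sum_wallSimplices {M : Type*} [AddCommMonoid M]
    (R : Finset (Fin m) → Fin m → M) :
    ∑ I ∈ Δ.maxSimplices, ∑ i ∈ I, R I i =
      ∑ J ∈ Δ.wallSimplices, ∑ i ∈ Δ.linkVertices J, R (insert i J) i := by
  rw [Finset.sum_sigma', Finset.sum_sigma']
  refine Finset.sum_bij' (fun x _ => ⟨x.1.erase x.2, x.2⟩) (fun x _ => ⟨insert x.2 x.1, x.2⟩)
    ?_ ?_ ?_ ?_ ?_ <;> rintro ⟨I, i⟩ h <;> rw [Finset.mem_sigma] at h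
  · obtain ⟨hJ, hi⟩ := erase_mem_wallSimplices h.1 h.2
    exact Finset.mem_sigma.2 ⟨hJ, hi⟩
  · exact Finset.mem_sigma.2 ⟨insert_mem_maxSimplices h.1 h.2, Finset.mem_insert_self i I⟩
  · simp only [Finset.insert_erase h.2]
  · simp only [Finset.erase_insert (mem_linkVertices.1 h.2).1]
  · simp only [Finset.insert_erase h.2]

end Walls

section Localization

variable (Δ : CompleteUnimodularFan n m) {I J : Finset (Fin m)} {a b : Fin m}
  {t w : Fin n → ℝ} {f : MvPolynomial (Fin m) ℝ}

/-- `t` lies on no hyperplane spanned by a wall, so that the denominators of the localization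
formula do not vanish at `t`. -/
def IsGeneric (t : Fin n → ℝ) : Prop :=
  ∀ I ∈ Δ.maxSimplices, ∀ i ∈ I, Δ.coord I i t ≠ 0

/-- The restriction of the equivariant class of a polynomial in the `v_i` to the torus-fixed point
`I`, evaluated at the element `t` of the Lie algebra of the torus. -/
def restrict (I : Finset (Fin m)) (t : Fin n → ℝ) : MvPolynomial (Fin m) ℝ →ₐ[ℝ] ℝ :=
  MvPolynomial.aeval fun i => Δ.coord I i t

/-- The localization formula for the integral over `X_Δ` of an equivariant class, evaluated at
`t`. It is meaningful only if `t` is generic. -/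
def integral (t : Fin n → ℝ) : MvPolynomial (Fin m) ℝ →ₗ[ℝ] ℝ :=
  ∑ I ∈ Δ.maxSimplices, (∏ i ∈ I, Δ.coord I i t)⁻¹ • (Δ.restrict I t).toLinearMap

/-- The term of the partial fraction decomposition of the summand of `integral t f` at the fixed
point `I` that belongs to the zero of `coord I i` on the line through `t` in direction `w`. -/
def residue (t w : Fin n → ℝ) (f : MvPolynomial (Fin m) ℝ) (I : Finset (Fin m)) (i : Fin m) : ℝ :=
  Δ.restrict I (kerPoint (Δ.coord I i) w t) f /
    ((∏ j ∈ I.erase i, Δ.coord I j (kerPoint (Δ.coord I i) w t)) * Δ.coord I i t)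

theorem integral_apply (t : Fin n → ℝ) (f : MvPolynomial (Fin m) ℝ) :
    Δ.integral t f = ∑ I ∈ Δ.maxSimplices, Δ.restrict I t f / ∏ i ∈ I, Δ.coord I i t := by
  simp [integral, div_eq_inv_mul]

theorem exists_isGeneric : ∃ t, Δ.IsGeneric t := by
  obtain ⟨t, ht⟩ := Module.Dual.exists_forall_ne_zero_of_forall_exists
    (fun p : Σ I : Δ.maxSimplices, I.1 => Δ.coord p.1 p.2) fun p =>
      DFunLike.ne_iff.1 (coord_ne_zero (mem_K_of_mem_maxSimplices p.1.2) p.2.2)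
  exact ⟨t, fun I hI i hi => ht ⟨⟨I, hI⟩, ⟨i, hi⟩⟩⟩

variable {Δ}

theorem IsGeneric.exists_direction (ht : Δ.IsGeneric t) :
    ∃ w, Δ.IsGeneric w ∧ ∀ I ∈ Δ.maxSimplices, ∀ i ∈ I, ∀ j ∈ I, i ≠ j →
      Δ.coord I i t * Δ.coord I j w ≠ Δ.coord I j t * Δ.coord I i w := by
  obtain ⟨w, hw⟩ := Module.Dual.exists_forall_ne_zero_of_forall_exists
    (Sum.elim (fun p : Σ I : Δ.maxSimplices, I.1 => Δ.coord p.1 p.2)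
      fun p : Σ I : Δ.maxSimplices, {q : I.1 × I.1 // q.1 ≠ q.2} =>
        Δ.coord p.1 p.2.1.1 t • Δ.coord p.1 p.2.1.2 - Δ.coord p.1 p.2.1.2 t • Δ.coord p.1 p.2.1.1)
    (by
      rintro (⟨I, i⟩ | ⟨I, ⟨⟨i, j⟩, hij⟩⟩)
      · exact DFunLike.ne_iff.1 (coord_ne_zero (mem_K_of_mem_maxSimplices I.2) i.2)
      · refine ⟨Δ.vec j, ?_⟩
        simpa [coord_vec (mem_K_of_mem_maxSimplices I.2) j.2, Subtype.coe_ne_coe.2 hij] using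
          ht I I.2 i i.2)
  exact ⟨w, fun I hI i hi => hw (.inl ⟨⟨I, hI⟩, ⟨i, hi⟩⟩), fun I hI i hi j hj hij =>
    sub_ne_zero.1 (hw (.inr ⟨⟨I, hI⟩, ⟨⟨⟨i, hi⟩, ⟨j, hj⟩⟩, Subtype.coe_ne_coe.1 hij⟩⟩))⟩

theorem integral_eq_sum_residue (hf : f.totalDegree < n) (ht : Δ.IsGeneric t)
    (hw : Δ.IsGeneric w) (htw : ∀ I ∈ Δ.maxSimplices, ∀ i ∈ I, ∀ j ∈ I, i ≠ j →
      Δ.coord I i t * Δ.coord I j w ≠ Δ.coord I j t * Δ.coord I i w) :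
    Δ.integral t f = ∑ I ∈ Δ.maxSimplices, ∑ i ∈ I, Δ.residue t w f I i := by
  rw [integral_apply]
  exact Finset.sum_congr rfl fun I hI => aeval_div_prod_eq_sum (Δ.coord I)
    (hf.trans_eq (mem_maxSimplices.1 hI).2.symm) (ht I hI) (hw I hI) (htw I hI)

theorem residue_insert_eq_neg (hJ : J ∈ Δ.wallSimplices) (ha : a ∈ Δ.linkVertices J)
    (hb : b ∈ Δ.linkVertices J) (hab : a ≠ b) (hw : Δ.IsGeneric w) :
    Δ.residue t w f (insert b J) b = -Δ.residue t w f (insert a J) a := by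
  obtain ⟨haJ, hA⟩ := mem_linkVertices.1 ha
  obtain ⟨hbJ, hB⟩ := mem_linkVertices.1 hb
  have hneg := coord_insert_eq_neg hJ ha hb hab
  set q := kerPoint (Δ.coord (insert a J) a) w t with hq
  have hqJ : q ∈ Δ.linSpan J := (coord_insert_eq_zero_iff hJ ha).1 <| apply_kerPoint_self
    (hw _ (insert_mem_maxSimplices hJ ha) a (Finset.mem_insert_self a J)) t
  have hcoord : ∀ j, Δ.coord (insert b J) j q = Δ.coord (insert a J) j q := fun j => by
    rw [coord_eq_coord_of_mem_linSpan hA (Finset.subset_insert a J) j hqJ,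
      coord_eq_coord_of_mem_linSpan hB (Finset.subset_insert b J) j hqJ]
  rw [residue, residue, hneg, kerPoint_neg, ← hq]
  simp only [restrict, hcoord, Finset.erase_insert haJ, Finset.erase_insert hbJ,
    LinearMap.neg_apply, mul_neg, div_neg]

theorem integral_eq_zero_of_totalDegree_lt (ht : Δ.IsGeneric t) (hf : f.totalDegree < n) :
    Δ.integral t f = 0 := by
  obtain ⟨w, hw, htw⟩ := ht.exists_direction
  rw [integral_eq_sum_residue hf ht hw htw, sum_maxSimplices_eq_sum_wallSimplices]
  refine Finset.sum_eq_zero fun J hJ => ?_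
  obtain ⟨a, b, hab, hlink⟩ := Finset.card_eq_two.1 (card_linkVertices hJ)
  rw [hlink, Finset.sum_pair hab, residue_insert_eq_neg hJ (by simp [hlink]) (by simp [hlink]) hab
    hw, add_neg_cancel]

theorem restrict_prod_X_eq_zero (hJI : ¬J ⊆ I) :
    Δ.restrict I t (∏ j ∈ J, MvPolynomial.X j) = 0 := by
  obtain ⟨j, hjJ, hjI⟩ := Finset.not_subset.1 hJI
  rw [map_prod]
  refine Finset.prod_eq_zero hjJ ?_
  rw [restrict, MvPolynomial.aeval_X, coord_of_notMem hjI, LinearMap.zero_apply]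

theorem integral_prod_X_mul (ht : Δ.IsGeneric t) (hJ : J ∈ Δ.wallSimplices)
    (f : MvPolynomial (Fin m) ℝ) :
    Δ.integral t ((∏ j ∈ J, MvPolynomial.X j) * f) =
      ∑ i ∈ Δ.linkVertices J, Δ.restrict (insert i J) t f / Δ.coord (insert i J) i t := by
  rw [integral_apply]
  refine (Finset.sum_of_injOn (insert · J) (fun a ha b _ hab => ?_)
    (fun i hi => insert_mem_maxSimplices hJ hi) (fun I hI hIJ => ?_) fun i hi => ?_).symm
  · have haJ := (mem_linkVertices.1 ha).1
    have hab : insert a J = insert b J := hab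
    exact (Finset.mem_insert.1 (hab ▸ Finset.mem_insert_self a J)).resolve_right haJ
  · obtain ⟨hIK, hIn⟩ := mem_maxSimplices.1 hI
    rw [map_mul, restrict_prod_X_eq_zero, zero_mul, zero_div]
    intro hJI
    have hne : J ≠ I := by
      rintro rfl
      have := (mem_wallSimplices.1 hJ).2
      omega
    exact hIJ (exists_linkVertices_insert_eq hJ hIK (hJI.ssubset_of_ne hne))
  · have hmax := insert_mem_maxSimplices hJ hi
    have hprod : Δ.restrict (insert i J) t (∏ j ∈ J, MvPolynomial.X j) =
        ∏ j ∈ J, Δ.coord (insert i J) j t := by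
      rw [map_prod]
      exact Finset.prod_congr rfl fun j _ => MvPolynomial.aeval_X _ j
    have hne : ∏ j ∈ J, Δ.coord (insert i J) j t ≠ 0 :=
      Finset.prod_ne_zero_iff.2 fun j hj => ht _ hmax j (Finset.mem_insert_of_mem hj)
    rw [map_mul, hprod, Finset.prod_insert (mem_linkVertices.1 hi).1,
      mul_comm (Δ.coord (insert i J) i t), mul_div_mul_left _ _ hne]

end Localization

section Divisors

variable {Δ : CompleteUnimodularFan n m} {I : Finset (Fin m)} {t : Fin n → ℝ}
  {ℓ : Module.Dual ℝ (Fin n → ℝ)}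

/-- The polynomial representing the torus-invariant divisor class with coefficients `c`. -/
def divisor (c : Fin m → ℝ) : MvPolynomial (Fin m) ℝ :=
  ∑ i, MvPolynomial.C (c i) * MvPolynomial.X i

theorem isHomogeneous_divisor (c : Fin m → ℝ) : (divisor c).IsHomogeneous 1 :=
  MvPolynomial.IsHomogeneous.sum _ _ _ fun i _ => MvPolynomial.isHomogeneous_C_mul_X (c i) i

theorem restrict_divisor (hI : I ∈ Δ.maxSimplices) {c : Fin m → ℝ}
    (h : ∀ i ∈ I, ℓ (Δ.vec i) = c i) : Δ.restrict I t (divisor c) = ℓ t := by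
  have hterm : ∀ i, Δ.restrict I t (MvPolynomial.C (c i) * MvPolynomial.X i) =
      c i * Δ.coord I i t := fun i => by
    rw [map_mul, restrict, MvPolynomial.aeval_C, MvPolynomial.aeval_X,
      Algebra.algebraMap_self_apply]
  calc Δ.restrict I t (divisor c) = ∑ i, c i * Δ.coord I i t := by
        simp only [divisor, map_sum, hterm]
    _ = ∑ i ∈ I, c i * Δ.coord I i t :=
        (Finset.sum_subset (Finset.subset_univ I) fun i _ hi => by
          rw [coord_of_notMem hi, LinearMap.zero_apply, mul_zero]).symm
    _ = ℓ (∑ i ∈ I, Δ.coord I i t • Δ.vec i) := by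
        rw [map_sum]
        exact Finset.sum_congr rfl fun i hi => by rw [map_smul, smul_eq_mul, h i hi, mul_comm]
    _ = ℓ t := by rw [sum_coord_smul hI t]

theorem integral_mul_divisor (ℓ : Module.Dual ℝ (Fin n → ℝ)) (t : Fin n → ℝ)
    (f : MvPolynomial (Fin m) ℝ) :
    Δ.integral t (f * divisor fun i => ℓ (Δ.vec i)) = ℓ t * Δ.integral t f := by
  rw [integral_apply, integral_apply, Finset.mul_sum]
  refine Finset.sum_congr rfl fun I hI => ?_
  rw [map_mul, restrict_divisor hI fun _ _ => rfl, mul_comm, mul_div_assoc]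

end Divisors

section DegreeMap

variable {Δ : CompleteUnimodularFan n m} {t : Fin n → ℝ} {f : MvPolynomial (Fin m) ℝ}

variable (Δ) in
/-- The localization formula for the integral, applied to the component of top degree. -/
def topIntegral (t : Fin n → ℝ) : MvPolynomial (Fin m) ℝ →ₗ[ℝ] ℝ :=
  Δ.integral t ∘ₗ MvPolynomial.homogeneousComponent n

theorem topIntegral_of_isHomogeneous (hf : f.IsHomogeneous n) :
    Δ.topIntegral t f = Δ.integral t f := by
  rw [topIntegral, LinearMap.comp_apply, MvPolynomial.homogeneousComponent_eq_self hf]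

theorem topIntegral_eq_zero_of_mem_stanleyReisnerIdeal (hf : f ∈ Δ.stanleyReisnerIdeal) :
    Δ.topIntegral t f = 0 := by
  refine map_eq_zero_of_mem_ideal_span _ ?_ hf
  rintro g _ ⟨J, hJ, rfl⟩
  rw [topIntegral, LinearMap.comp_apply,
    homogeneousComponent_mul_of_isHomogeneous (isHomogeneous_prod_X J)]
  split_ifs
  · rw [integral_apply]
    refine Finset.sum_eq_zero fun I hI => ?_
    have hJI : ¬J ⊆ I := fun h => hJ (Δ.down_closed I (mem_K_of_mem_maxSimplices hI) J h)
    rw [map_mul, restrict_prod_X_eq_zero hJI, mul_zero, zero_div]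
  · exact map_zero _

theorem topIntegral_eq_zero_of_mem_linearIdeal (ht : Δ.IsGeneric t) (hf : f ∈ Δ.linearIdeal) :
    Δ.topIntegral t f = 0 := by
  refine map_eq_zero_of_mem_ideal_span _ ?_ hf
  rintro g _ ⟨μ, rfl⟩
  have hdiv : ∑ i, MvPolynomial.C ((μ (Δ.lam i) : ℤ) : ℝ) * MvPolynomial.X i =
      divisor fun i => realExtension μ (Δ.vec i) := by
    simp only [divisor, vec, realExtension_latticeVec]
  rw [hdiv, topIntegral, LinearMap.comp_apply,
    homogeneousComponent_mul_of_isHomogeneous (isHomogeneous_divisor _)]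
  split_ifs with hn
  · have hdeg : (MvPolynomial.homogeneousComponent (n - 1) g).totalDegree < n :=
      (MvPolynomial.homogeneousComponent_isHomogeneous (n - 1) g).totalDegree_le.trans_lt
        (Nat.sub_one_lt_of_lt hn)
    rw [integral_mul_divisor, integral_eq_zero_of_totalDegree_lt ht hdeg, mul_zero]
  · exact map_zero _

theorem topIntegral_eq_zero_of_mem_sup (ht : Δ.IsGeneric t)
    (hf : f ∈ Δ.stanleyReisnerIdeal ⊔ Δ.linearIdeal) : Δ.topIntegral t f = 0 := by
  obtain ⟨g, hg, h, hh, rfl⟩ := Submodule.mem_sup.1 hf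
  rw [map_add, topIntegral_eq_zero_of_mem_stanleyReisnerIdeal hg,
    topIntegral_eq_zero_of_mem_linearIdeal ht hh, add_zero]

variable (Δ) in
/-- The class of a polynomial in the `v_i`. -/
abbrev toCohomology : MvPolynomial (Fin m) ℝ →ₐ[ℝ] Δ.Cohomology :=
  Ideal.Quotient.mkₐ ℝ (Δ.stanleyReisnerIdeal ⊔ Δ.linearIdeal)

/-- The integral over `X_Δ`, as a linear form on the cohomology vanishing outside the top degree. It
is computed by localization at a generic `t`. -/
def degreeMap (ht : Δ.IsGeneric t) : Module.Dual ℝ Δ.Cohomology :=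
  (((Δ.stanleyReisnerIdeal ⊔ Δ.linearIdeal).restrictScalars ℝ).liftQ (Δ.topIntegral t)
    fun _ hf => topIntegral_eq_zero_of_mem_sup ht hf) ∘ₗ
      (Submodule.Quotient.restrictScalarsEquiv ℝ
        (Δ.stanleyReisnerIdeal ⊔ Δ.linearIdeal)).symm.toLinearMap

theorem degreeMap_toCohomology_of_isHomogeneous (ht : Δ.IsGeneric t) (hf : f.IsHomogeneous n) :
    degreeMap ht (Δ.toCohomology f) = Δ.integral t f :=
  topIntegral_of_isHomogeneous hf

end DegreeMap

section StrictConvexity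

/-- The piecewise linear function that is `p I` on the cone of `I` and takes the value `h i` at
`vec i` is well defined and strictly convex. -/
structure IsStrictlyConvexSupport (Δ : CompleteUnimodularFan n m) (h : Fin m → ℝ)
    (p : Finset (Fin m) → Module.Dual ℝ (Fin n → ℝ)) : Prop where
  apply_vec_eq : ∀ I ∈ Δ.maxSimplices, ∀ i ∈ I, p I (Δ.vec i) = h i
  apply_vec_le : ∀ I ∈ Δ.maxSimplices, ∀ i, p I (Δ.vec i) ≤ h i
  injOn : Set.InjOn p Δ.maxSimplices

variable {Δ : CompleteUnimodularFan n m} {I J : Finset (Fin m)} {t : Fin n → ℝ}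
  {P : Set (Fin n → ℝ)}

theorem exists_face_normalCone_eq (hP : normalFan P = Δ.cones) (hI : I ∈ Δ.K) :
    ∃ F : Set (Fin n → ℝ), F.Nonempty ∧ F ⊆ P ∧ normalCone P F = Δ.cone I ∧
      ∀ x ∈ F, ∀ i ∈ I, IsMaxOn (· ⬝ᵥ Δ.vec i) P x := by
  obtain ⟨F, ⟨hne, hexp⟩, hF⟩ : Δ.cone I ∈ normalFan P := hP ▸ ⟨I, hI, rfl⟩
  exact ⟨F, hne, hexp.subset, hF.symm, fun x hx i hi =>
    isMaxOn_dotProduct_of_mem_normalCone (hF ▸ vec_mem_cone hi) hx⟩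

theorem exists_vertex_normalCone_eq (hP : normalFan P = Δ.cones) (hI : I ∈ Δ.maxSimplices) :
    ∃ x ∈ P, normalCone P {x} = Δ.cone I ∧ ∀ i ∈ I, IsMaxOn (· ⬝ᵥ Δ.vec i) P x := by
  obtain ⟨F, ⟨x, hx⟩, hFP, hF, hmax⟩ :=
    exists_face_normalCone_eq hP (mem_K_of_mem_maxSimplices hI)
  have hFx : F = {x} := Set.eq_singleton_iff_unique_mem.2 ⟨hx, fun y hy =>
    (dotProductEquiv ℝ (Fin n)).injective <| dual_ext hI fun i hi =>
      le_antisymm (hmax x hx i hi (hFP hy)) (hmax y hy i hi (hFP hx))⟩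
  exact ⟨x, hFP hx, hFx ▸ hF, hmax x hx⟩

theorem IsPolytopal.exists_isStrictlyConvexSupport (hΔ : Δ.IsPolytopal) :
    ∃ h p, Δ.IsStrictlyConvexSupport h p := by
  obtain ⟨P, -, hP⟩ := hΔ
  have hray : ∀ i, ∃ y ∈ P, IsMaxOn (· ⬝ᵥ Δ.vec i) P y := fun i => by
    obtain ⟨F, ⟨y, hy⟩, hFP, -, hmax⟩ := exists_face_normalCone_eq hP (Δ.singleton_mem i)
    exact ⟨y, hFP hy, hmax y hy i (Finset.mem_singleton_self i)⟩
  choose y hyP hymax using hray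
  choose! x hxP hxcone hxmax using fun I hI => exists_vertex_normalCone_eq (I := I) hP hI
  refine ⟨fun i => y i ⬝ᵥ Δ.vec i, fun I => dotProductEquiv ℝ (Fin n) (x I),
    fun I hI i hi => le_antisymm (hymax i (hxP I hI)) (hxmax I hI i hi (hyP i)),
    fun I hI i => hymax i (hxP I hI), fun I hI J hJ hIJ => ?_⟩
  have hxIJ : x I = x J := (dotProductEquiv ℝ (Fin n)).injective hIJ
  refine Δ.cone_injOn (mem_K_of_mem_maxSimplices hI) (mem_K_of_mem_maxSimplices hJ) ?_
  rw [← hxcone I hI, ← hxcone J hJ, hxIJ]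

variable {h : Fin m → ℝ} {p : Finset (Fin m) → Module.Dual ℝ (Fin n → ℝ)}

theorem IsStrictlyConvexSupport.apply_vec_lt {a b : Fin m} (hp : Δ.IsStrictlyConvexSupport h p)
    (hJ : J ∈ Δ.wallSimplices) (ha : a ∈ Δ.linkVertices J) (hb : b ∈ Δ.linkVertices J)
    (hab : a ≠ b) : p (insert b J) (Δ.vec a) < h a := by
  have hA := insert_mem_maxSimplices hJ ha
  have hB := insert_mem_maxSimplices hJ hb
  refine (hp.apply_vec_le _ hB a).lt_of_ne fun heq => ?_
  have hpAB : p (insert a J) = p (insert b J) := dual_ext hA fun j hj => by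
    rw [hp.apply_vec_eq _ hA j hj]
    rcases Finset.mem_insert.1 hj with rfl | hjJ
    · exact heq.symm
    · exact (hp.apply_vec_eq _ hB j (Finset.mem_insert_of_mem hjJ)).symm
  have haB : a ∈ insert b J := hp.injOn hA hB hpAB ▸ Finset.mem_insert_self a J
  exact (mem_linkVertices.1 ha).1 ((Finset.mem_insert.1 haB).resolve_left hab)

/-- By localization the integral is the slope by which the support function bends across the
wall. -/
theorem IsStrictlyConvexSupport.integral_prod_X_mul_divisor_pos
    (hp : Δ.IsStrictlyConvexSupport h p) (ht : Δ.IsGeneric t) (hJ : J ∈ Δ.wallSimplices) :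
    0 < Δ.integral t ((∏ j ∈ J, MvPolynomial.X j) * divisor h) := by
  obtain ⟨a, b, hab, hlink⟩ := Finset.card_eq_two.1 (card_linkVertices hJ)
  have ha : a ∈ Δ.linkVertices J := by simp [hlink]
  have hb : b ∈ Δ.linkVertices J := by simp [hlink]
  have hA := insert_mem_maxSimplices hJ ha
  have hB := insert_mem_maxSimplices hJ hb
  have haA := Finset.mem_insert_self a J
  have hbend : p (insert a J) - p (insert b J) =
      (h a - p (insert b J) (Δ.vec a)) • Δ.coord (insert a J) a := by
    rw [← hp.apply_vec_eq _ hA a haA, ← LinearMap.sub_apply]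
    refine eq_smul_coord_insert hJ ha fun j hj => ?_
    rw [LinearMap.sub_apply, hp.apply_vec_eq _ hA j (Finset.mem_insert_of_mem hj),
      hp.apply_vec_eq _ hB j (Finset.mem_insert_of_mem hj), sub_self]
  have hslope : Δ.integral t ((∏ j ∈ J, MvPolynomial.X j) * divisor h) =
      h a - p (insert b J) (Δ.vec a) :=
    calc _ = p (insert a J) t / Δ.coord (insert a J) a t +
          p (insert b J) t / Δ.coord (insert b J) b t := by
          rw [integral_prod_X_mul ht hJ, hlink, Finset.sum_pair hab,
            restrict_divisor hA (hp.apply_vec_eq _ hA), restrict_divisor hB (hp.apply_vec_eq _ hB)]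
      _ = (p (insert a J) - p (insert b J)) t / Δ.coord (insert a J) a t := by
          rw [coord_insert_eq_neg hJ ha hb hab, LinearMap.neg_apply, div_neg, ← sub_eq_add_neg,
            ← sub_div, LinearMap.sub_apply]
      _ = h a - p (insert b J) (Δ.vec a) := by
          rw [hbend, LinearMap.smul_apply, smul_eq_mul, mul_div_cancel_right₀ _ (ht _ hA a haA)]
  rw [hslope]
  exact sub_pos.2 (hp.apply_vec_lt hJ ha hb hab)

end StrictConvexity

section WallClasses

variable {Δ : CompleteUnimodularFan n m}

instance : Finite Δ.Wall :=
  inferInstanceAs (Finite {J : Finset (Fin m) // J ∈ Δ.K ∧ J.card + 1 = n})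

theorem coe_wallClass (J : Δ.Wall) :
    (Δ.wallClass J : Δ.Cohomology) = Δ.toCohomology (∏ j ∈ J.1, MvPolynomial.X j) :=
  (map_prod _ _ _).symm

theorem degreeMap_wallClass_mul_divisor {t : Fin n → ℝ} (ht : Δ.IsGeneric t) (J : Δ.Wall)
    (c : Fin m → ℝ) :
    degreeMap ht (Δ.wallClass J * Δ.toCohomology (divisor c)) =
      Δ.integral t ((∏ j ∈ J.1, MvPolynomial.X j) * divisor c) := by
  have hhom : ((∏ j ∈ J.1, MvPolynomial.X j) * divisor c).IsHomogeneous n := by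
    simpa only [J.2.2] using (isHomogeneous_prod_X J.1).mul (isHomogeneous_divisor c)
  rw [coe_wallClass, ← map_mul, degreeMap_toCohomology_of_isHomogeneous ht hhom]

theorem IsPolytopal.exists_dual_wallClass_pos (hΔ : Δ.IsPolytopal) :
    ∃ ψ : Module.Dual ℝ (Δ.evenCohomology (n - 1)), ∀ J, 0 < ψ (Δ.wallClass J) := by
  obtain ⟨h, p, hp⟩ := hΔ.exists_isStrictlyConvexSupport
  obtain ⟨t, ht⟩ := Δ.exists_isGeneric
  refine ⟨degreeMap ht ∘ₗ LinearMap.mulRight ℝ (Δ.toCohomology (divisor h)) ∘ₗ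
    Submodule.subtype _, fun J => ?_⟩
  exact (hp.integral_prod_X_mul_divisor_pos ht (mem_wallSimplices.2 J.2)).trans_eq
    (degreeMap_wallClass_mul_divisor ht J h).symm

end WallClasses

end CompleteUnimodularFan

end

/-- For a smooth projective toric variety `X_Δ`, the effective cone `NE(X_Δ)` is polyhedral
(finitely generated) and strictly convex (it contains no line), and its generators `v_J` are
nonzero. -/
theorem mainTheorem5 {n m : ℕ} (Δ : CompleteUnimodularFan n m) (hΔ : Δ.IsPolytopal) :
    Δ.effectiveCone.FG ∧
    (Δ.effectiveCone : ConvexCone ℝ (Δ.evenCohomology (n - 1))).Salient ∧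
    ∀ J : Δ.Wall, Δ.wallClass J ≠ 0 := by
  obtain ⟨ψ, hψ⟩ := hΔ.exists_dual_wallClass_pos
  refine ⟨Submodule.fg_span (Set.finite_range _), salient_hull_of_pos (Set.forall_mem_range.2 hψ),
    fun J hJ => ?_⟩
  exact (hψ J).ne' (by rw [hJ, map_zero])
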